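/- For a finite set $A$ of integers write $A+A=\{a_1+a_2 : a_1,a_2\in A\}$ and $A-A=\{a_1-a_2 : a_1,a_2\in A\}$. Let $j,k$ be any two non-negative integers. Then there exists a constant $c_{j,k}\in(0,1)$, depending only on $j$ and $k$, such that for all sufficiently large integers $n$ (how large depending on $j$ and $k$), at least $c_{j,k}\cdot 2^{n+1}$ of the subsets $A$ of $\{0,1,2,\dots,n\}$ satisfy both $|A+A|=(2n+1)-j$ and $|A-A|=(2n+1)-2k$. -/

import Mathlib

open scoped Pointwise

/-! Missing sums and differences can be placed near the ends and avoided elsewhere. Fix `A` within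
`m` of each end of `[0, n]`, with `m` depending only on `j` and `k`, and leave the middle free.
Small sums see only the left fringe, large sums only the right one, and differences near `±n` pair
one with the other. The fringes lose exactly `j` small sums, no large sum, and `k` differences of
each sign. Every other nonzero value is represented by many disjoint pairs; a random middle misses
all of them with probability at most `(3/4) ^ r`, `r` being the number of pairs. `r` grows linearly
towards the centre, so a geometric union bound leaves at least an eighth of the middles good. The
fixed fringes cost only the constant factor `2 ^ (2 * m)`. -/

/-! ### Sets avoiding a matching -/

/-- Among the subsets of `U`, those containing no pair `{a, φ a}` of a matching `M` form a
proportion of at most `(3/4) ^ #M`. -/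
theorem card_avoid_matching_le (φ : ℤ → ℤ) (M : Finset ℤ) : ∀ U : Finset ℤ,
    M ⊆ U → (∀ a ∈ M, φ a ∈ U) → Set.InjOn φ M → (∀ a ∈ M, φ a ∉ M) →
    (U.powerset.filter (fun B => ∀ a ∈ M, ¬ (a ∈ B ∧ φ a ∈ B))).card * 4 ^ M.card
      ≤ 3 ^ M.card * 2 ^ U.card := by
  induction M using Finset.induction_on with
  | empty => intro U _ _ _ _; simp
  | insert x M hx ih =>
    intro U hMU hφU hinj hdis
    have hxU : x ∈ U := hMU (Finset.mem_insert_self _ _)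
    have hyU : φ x ∈ U := hφU x (Finset.mem_insert_self _ _)
    have hyM : φ x ∉ insert x M := hdis x (Finset.mem_insert_self _ _)
    have hyx : φ x ≠ x := fun h => hyM (by rw [h]; exact Finset.mem_insert_self _ _)
    have hyM' : φ x ∉ M := fun h => hyM (Finset.mem_insert_of_mem h)
    set V := (U.erase x).erase (φ x) with hV
    have hVcard : U.card = V.card + 2 := by
      have h1 : (U.erase x).card + 1 = U.card := Finset.card_erase_add_one hxU
      have h2 : V.card + 1 = (U.erase x).card :=
        Finset.card_erase_add_one (Finset.mem_erase.2 ⟨hyx, hyU⟩)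
      omega
    have hφne : ∀ a ∈ M, φ a ≠ x ∧ φ a ≠ φ x ∧ a ≠ x ∧ a ≠ φ x := by
      intro a ha
      have hax : a ≠ x := fun h => hx (h ▸ ha)
      refine ⟨fun h => hdis a (Finset.mem_insert_of_mem ha) ?_, fun h => hax ?_, hax,
        fun h => hyM' (h ▸ ha)⟩
      · rw [h]; exact Finset.mem_insert_self _ _
      · exact hinj (by simp [ha]) (by simp) h
    have key := ih V
      (fun a ha => by
        have := hφne a ha
        simp [hV, this, hMU (Finset.mem_insert_of_mem ha)])
      (fun a ha => by
        have := hφne a ha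
        simp [hV, this, hφU a (Finset.mem_insert_of_mem ha)])
      (fun a ha b hb h => hinj (by simp at ha; simp [ha]) (by simp at hb; simp [hb]) h)
      (fun a ha h => hdis a (Finset.mem_insert_of_mem ha) (Finset.mem_insert_of_mem h))
    set T := V.powerset.filter (fun B => ∀ a ∈ M, ¬ (a ∈ B ∧ φ a ∈ B)) with hT
    -- Of the four traces on `{x, φ x}` only three are allowed; off that pair, `B` restricts to a
    -- member of `T`.
    have hsub : U.powerset.filter (fun B => ∀ a ∈ insert x M, ¬ (a ∈ B ∧ φ a ∈ B)) ⊆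
        T ∪ (T.image (fun B => insert x B) ∪ T.image (fun B => insert (φ x) B)) := by
      intro B hB
      rw [Finset.mem_filter, Finset.mem_powerset] at hB
      obtain ⟨hBU, hB⟩ := hB
      have hC : (B.erase x).erase (φ x) ∈ T := by
        rw [hT, Finset.mem_filter, Finset.mem_powerset]
        refine ⟨Finset.erase_subset_erase _ (Finset.erase_subset_erase _ hBU), ?_⟩
        intro a ha h
        exact hB a (Finset.mem_insert_of_mem ha)
          ⟨Finset.mem_of_mem_erase (Finset.mem_of_mem_erase h.1),
            Finset.mem_of_mem_erase (Finset.mem_of_mem_erase h.2)⟩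
      have hnot := hB x (Finset.mem_insert_self _ _)
      simp only [Finset.mem_union, Finset.mem_image]
      by_cases h1 : x ∈ B
      · have h2 : φ x ∉ B := fun h => hnot ⟨h1, h⟩
        refine Or.inr (Or.inl ⟨_, hC, ?_⟩)
        rw [Finset.erase_eq_of_notMem (fun h => h2 (Finset.mem_of_mem_erase h)),
          Finset.insert_erase h1]
      · by_cases h2 : φ x ∈ B
        · refine Or.inr (Or.inr ⟨_, hC, ?_⟩)
          rw [Finset.erase_eq_of_notMem h1, Finset.insert_erase h2]
        · refine Or.inl ?_
          rwa [Finset.erase_eq_of_notMem h1, Finset.erase_eq_of_notMem h2] at hC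
    have hle : (U.powerset.filter
        (fun B => ∀ a ∈ insert x M, ¬ (a ∈ B ∧ φ a ∈ B))).card ≤ 3 * T.card := by
      refine (Finset.card_le_card hsub).trans ((Finset.card_union_le _ _).trans ?_)
      have h1 := Finset.card_union_le (T.image (fun B => insert x B))
        (T.image (fun B => insert (φ x) B))
      have h2 : (T.image (fun B => insert x B)).card ≤ T.card := Finset.card_image_le
      have h3 : (T.image (fun B => insert (φ x) B)).card ≤ T.card := Finset.card_image_le
      omega
    rw [Finset.card_insert_of_notMem hx, hVcard]
    calc _ ≤ 3 * T.card * 4 ^ (M.card + 1) := Nat.mul_le_mul_right _ hle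
      _ = 12 * (T.card * 4 ^ M.card) := by ring
      _ ≤ 12 * (3 ^ M.card * 2 ^ V.card) := Nat.mul_le_mul_left _ key
      _ = _ := by ring

/-- The bound `card_avoid_matching_le` persists when a set `G` of elements is forced in. -/
theorem card_avoid_matching_forced_le (φ : ℤ → ℤ) (M U G F : Finset ℤ) (hUG : Disjoint U G)
    (hGF : G ⊆ F) (hM : ∀ a ∈ M, a ∈ U ∪ G ∧ φ a ∈ U ∪ G ∧ φ a ∉ M) (hinj : Set.InjOn φ M)
    (r : ℕ) (hr : r ≤ M.card) :
    ((U.powerset.filter (fun B => ∀ a ∈ M, ¬ (a ∈ F ∪ B ∧ φ a ∈ F ∪ B))).card : ℝ)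
      ≤ (3 / 4 : ℝ) ^ r * 2 ^ U.card := by
  set T := U.powerset.filter (fun B => ∀ a ∈ M, ¬ (a ∈ F ∪ B ∧ φ a ∈ F ∪ B)) with hT
  have h1 := card_avoid_matching_le φ M (U ∪ G) (fun a ha => (hM a ha).1)
    (fun a ha => (hM a ha).2.1) hinj (fun a ha => (hM a ha).2.2)
  set T' := (U ∪ G).powerset.filter (fun B => ∀ a ∈ M, ¬ (a ∈ B ∧ φ a ∈ B)) with hT'
  -- Avoidance passes to subsets: since `B ∪ X ⊆ F ∪ B`, each `B` in `T` yields `2 ^ #G` members of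
  -- `T'`, one per `X ⊆ G`.
  have h2 : T.card * 2 ^ G.card ≤ T'.card := by
    rw [← Finset.card_powerset, ← Finset.card_product]
    refine Finset.card_le_card_of_injOn (fun p => p.1 ∪ p.2) ?_ ?_
    · rintro ⟨B, X⟩ h
      simp only [hT, Finset.coe_product, Set.mem_prod, Finset.mem_coe, Finset.mem_filter,
        Finset.mem_powerset] at h
      simp only [hT', Finset.mem_coe, Finset.mem_filter, Finset.mem_powerset]
      refine ⟨Finset.union_subset_union h.1.1 h.2, fun a ha hab => h.1.2 a ha ?_⟩
      have hX : B ∪ X ⊆ F ∪ B := by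
        rw [Finset.union_comm F B]
        exact Finset.union_subset_union_right (h.2.trans hGF)
      exact ⟨hX hab.1, hX hab.2⟩
    · rintro ⟨B, X⟩ h ⟨C, Y⟩ h' heq
      simp only [hT, Finset.coe_product, Set.mem_prod, Finset.mem_coe, Finset.mem_filter,
        Finset.mem_powerset] at h h'
      simp only at heq
      have hd : ∀ a, a ∈ U → a ∉ G := fun a ha hb => Finset.disjoint_left.1 hUG ha hb
      have e : ∀ a, (a ∈ B ∨ a ∈ X) ↔ (a ∈ C ∨ a ∈ Y) := by
        intro a; simpa using Finset.ext_iff.1 heq a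
      have hB := fun a (ha : a ∈ B) => h.1.1 ha
      have hX := fun a (ha : a ∈ X) => h.2 ha
      have hC := fun a (ha : a ∈ C) => h'.1.1 ha
      have hY := fun a (ha : a ∈ Y) => h'.2 ha
      have e1 : B = C := by
        ext a; have := e a; have := hB a; have := hX a; have := hC a; have := hY a
        have := hd a; tauto
      have e2 : X = Y := by
        ext a; have := e a; have := hB a; have := hX a; have := hC a; have := hY a
        have := hd a; tauto
      rw [e1, e2]
  rw [Finset.card_union_of_disjoint hUG] at h1
  have h3 : T.card * 4 ^ M.card ≤ 3 ^ M.card * 2 ^ U.card := by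
    have h4 : (T.card * 4 ^ M.card) * 2 ^ G.card ≤ (3 ^ M.card * 2 ^ U.card) * 2 ^ G.card := by
      calc _ = (T.card * 2 ^ G.card) * 4 ^ M.card := by ring
        _ ≤ T'.card * 4 ^ M.card := Nat.mul_le_mul_right _ h2
        _ ≤ _ := h1
        _ = _ := by ring
    exact Nat.le_of_mul_le_mul_right h4 (by positivity)
  have h5 : (T.card : ℝ) * 4 ^ M.card ≤ 3 ^ M.card * 2 ^ U.card := by exact_mod_cast h3
  calc (T.card : ℝ) ≤ (3 / 4 : ℝ) ^ M.card * 2 ^ U.card := by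
        rw [div_pow, div_mul_eq_mul_div, le_div_iff₀ (by positivity)]; exact h5
    _ ≤ _ := by
        gcongr ?_ * _
        exact pow_le_pow_of_le_one (by norm_num) (by norm_num) hr

theorem sum_range_three_quarters_pow_half_le (N : ℕ) :
    ∑ i ∈ Finset.range N, (3 / 4 : ℝ) ^ (12 + i / 2) ≤ 8 * (3 / 4 : ℝ) ^ 12 := by
  have h : ∀ K : ℕ, ∑ i ∈ Finset.range (2 * K), (3 / 4 : ℝ) ^ (12 + i / 2)
      = 8 * (3 / 4 : ℝ) ^ 12 * (1 - (3 / 4) ^ K) := by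
    intro K
    induction K with
    | zero => simp
    | succ K ih =>
      rw [show 2 * (K + 1) = 2 * K + 1 + 1 by ring, Finset.sum_range_succ, Finset.sum_range_succ,
        ih, show 2 * K / 2 = K by omega, show (2 * K + 1) / 2 = K by omega]
      ring
  calc _ ≤ ∑ i ∈ Finset.range (2 * N), (3 / 4 : ℝ) ^ (12 + i / 2) :=
        Finset.sum_le_sum_of_subset_of_nonneg (by simp; omega) (fun _ _ _ => by positivity)
    _ = _ := h N
    _ ≤ _ := by
        have : (0 : ℝ) ≤ (3 / 4) ^ N := by positivity
        have h12 : (0 : ℝ) ≤ 8 * (3 / 4) ^ 12 := by positivity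
        nlinarith

/-! ### Filling the middle -/

/-- If `A` contains `G = [W, m) ∪ (n - m, n - W]`, then for at least an eighth of the choices of
`A` on `[m, n - m]` every sum in `[2m - 1, 2n - 2m + 1]` and every difference in
`[1, n - 2m + 1]` is attained. -/
theorem eighth_le_card_full_middle (n m W : ℤ) (hm : W + 12 ≤ m) (hn : 2 * m ≤ n)
    (F : Finset ℤ)
    (hF : ∀ x, (W ≤ x ∧ x < m) ∨ (n - m < x ∧ x ≤ n - W) → x ∈ F) :
    (2 : ℝ) ^ (Finset.Icc m (n - m)).card / 8 ≤
      (((Finset.Icc m (n - m)).powerset.filter (fun B =>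
        (∀ s, 2 * m - 1 ≤ s → s ≤ 2 * n - 2 * m + 1 → ∃ a ∈ F ∪ B, s - a ∈ F ∪ B) ∧
        (∀ d, 1 ≤ d → d ≤ n - 2 * m + 1 → ∃ a ∈ F ∪ B, a + d ∈ F ∪ B))).card : ℝ) := by
  set U := Finset.Icc m (n - m) with hU
  set G := Finset.Icc W (m - 1) ∪ Finset.Icc (n - m + 1) (n - W) with hG
  have hUG : Disjoint U G := by
    rw [Finset.disjoint_left]
    intro a ha hb
    simp only [hU, hG, Finset.mem_union, Finset.mem_Icc] at ha hb
    omega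
  have hGF : G ⊆ F := by
    intro a ha
    simp only [hG, Finset.mem_union, Finset.mem_Icc] at ha
    exact hF a (by omega)
  have hmem : ∀ a, a ∈ U ∪ G ↔ W ≤ a ∧ a ≤ n - W := by
    intro a
    simp only [hU, hG, Finset.mem_union, Finset.mem_Icc]
    omega
  set bad : (ℤ → ℤ) → Finset ℤ → Finset (Finset ℤ) := fun φ M =>
    U.powerset.filter (fun B => ∀ a ∈ M, ¬ (a ∈ F ∪ B ∧ φ a ∈ F ∪ B)) with hbad
  set N := (n + 1 - (2 * m - 1)).toNat with hN
  -- The index `i` stands for the sums `2m - 1 + i` and `2n - (2m - 1 + i)` and the difference `n -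
  -- (2m - 1 + i)`. Each matching has at least `m - W + i / 2 ≥ 12 + i / 2` pairs.
  set M1 : ℕ → Finset ℤ := fun i => Finset.Icc W ((2 * m - 1 + i - 1) / 2) with hM1
  set M2 : ℕ → Finset ℤ := fun i => Finset.Icc ((2 * n - (2 * m - 1 + i)) / 2 + 1) (n - W) with hM2
  -- The pairs `{a, a + d}` overlap in chains; keeping `a` only in alternate blocks of length `d`
  -- makes them disjoint.
  set M3 : ℕ → Finset ℤ := fun i => (Finset.Icc W (2 * m - 1 + i - W)).filter
    (fun a => (a - W) % (2 * (n - (2 * m - 1 + i))) < n - (2 * m - 1 + i)) with hM3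
  have b1 : ∀ i ∈ Finset.range N, ((bad (fun a => (2 * m - 1 + i) - a) (M1 i)).card : ℝ)
      ≤ (3 / 4 : ℝ) ^ (12 + i / 2) * 2 ^ U.card := by
    intro i hi
    rw [Finset.mem_range] at hi
    refine card_avoid_matching_forced_le _ _ U G F hUG hGF ?_ ?_ _ ?_
    · intro a ha
      simp only [hmem, hM1, Finset.mem_Icc] at ha ⊢
      omega
    · intro a _ b _ h
      simp only at h
      omega
    · simp only [hM1, Int.card_Icc]
      omega
  have b2 : ∀ i ∈ Finset.range N, ((bad (fun a => (2 * n - (2 * m - 1 + i)) - a) (M2 i)).card : ℝ)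
      ≤ (3 / 4 : ℝ) ^ (12 + i / 2) * 2 ^ U.card := by
    intro i hi
    rw [Finset.mem_range] at hi
    refine card_avoid_matching_forced_le _ _ U G F hUG hGF ?_ ?_ _ ?_
    · intro a ha
      simp only [hmem, hM2, Finset.mem_Icc] at ha ⊢
      omega
    · intro a _ b _ h
      simp only at h
      omega
    · simp only [hM2, Int.card_Icc]
      omega
  have b3 : ∀ i ∈ Finset.range (N - 1), ((bad (fun a => a + (n - (2 * m - 1 + i))) (M3 i)).card : ℝ)
      ≤ (3 / 4 : ℝ) ^ (12 + i / 2) * 2 ^ U.card := by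
    intro i hi
    rw [Finset.mem_range] at hi
    obtain ⟨d, hd⟩ : ∃ d, d = n - (2 * m - 1 + i) := ⟨_, rfl⟩
    have hd0 : 0 < d := by omega
    have shift : ∀ x : ℤ, d ≤ x % (2 * d) → (x - d) % (2 * d) = x % (2 * d) - d := by
      intro x hx
      have h1 := Int.emod_add_mul_ediv x (2 * d)
      have h2 := Int.emod_lt_of_pos x (show 0 < 2 * d by omega)
      have h3 : x - d = (x % (2 * d) - d) + 2 * d * (x / (2 * d)) := by linarith
      rw [h3, Int.add_mul_emod_self_left]
      exact Int.emod_eq_of_lt (by omega) (by omega)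
    have shift' : ∀ x : ℤ, x % (2 * d) < d → (x + d) % (2 * d) = x % (2 * d) + d := by
      intro x hx
      have h1 := Int.emod_add_mul_ediv x (2 * d)
      have h2 := Int.emod_nonneg x (show 2 * d ≠ 0 by omega)
      have h3 : x + d = (x % (2 * d) + d) + 2 * d * (x / (2 * d)) := by linarith
      rw [h3, Int.add_mul_emod_self_left]
      exact Int.emod_eq_of_lt (by omega) (by omega)
    have hM3' : M3 i = (Finset.Icc W (n - W - d)).filter (fun a => (a - W) % (2 * d) < d) := by
      simp only [hM3, ← hd]
      congr 2
      omega
    rw [← hd, hM3']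
    refine card_avoid_matching_forced_le _ _ U G F hUG hGF ?_ ?_ _ ?_
    · intro a ha
      simp only [Finset.mem_filter, Finset.mem_Icc] at ha
      simp only [hmem, Finset.mem_filter, Finset.mem_Icc]
      refine ⟨by omega, by omega, fun h => ?_⟩
      have h4 := shift' (a - W) ha.2
      have h5 := h.2
      rw [show a + d - W = a - W + d by ring, h4] at h5
      have h2 := Int.emod_nonneg (a - W) (show 2 * d ≠ 0 by omega)
      omega
    · intro a _ b _ h
      simp only at h
      omega
    · set M := (Finset.Icc W (n - W - d)).filter (fun a => (a - W) % (2 * d) < d) with hM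
      have hcov : Finset.Icc W (n - W - d) ⊆ M ∪ M.image (fun a => a + d) := by
        intro a ha
        rw [Finset.mem_union, Finset.mem_image]
        by_cases hlt : (a - W) % (2 * d) < d
        · exact Or.inl (Finset.mem_filter.2 ⟨ha, hlt⟩)
        · refine Or.inr ⟨a - d, ?_, by ring⟩
          rw [Finset.mem_Icc] at ha
          have h4 := shift (a - W) (by omega)
          have h2 := Int.emod_lt_of_pos (a - W) (show 0 < 2 * d by omega)
          have h1 := Int.emod_add_mul_ediv (a - W) (2 * d)
          have h6 : 0 ≤ (a - W) / (2 * d) := Int.ediv_nonneg (by omega) (by omega)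
          have h7 : 0 ≤ 2 * d * ((a - W) / (2 * d)) := by positivity
          rw [hM, Finset.mem_filter, Finset.mem_Icc, show a - d - W = a - W - d by ring, h4]
          omega
      have h1 := Finset.card_le_card hcov
      have h2 := Finset.card_union_le M (M.image (fun a => a + d))
      have h3 : (M.image (fun a => a + d)).card ≤ M.card := Finset.card_image_le
      rw [Int.card_Icc] at h1
      omega
  set good := U.powerset.filter (fun B =>
        (∀ s, 2 * m - 1 ≤ s → s ≤ 2 * n - 2 * m + 1 → ∃ a ∈ F ∪ B, s - a ∈ F ∪ B) ∧
        (∀ d, 1 ≤ d → d ≤ n - 2 * m + 1 → ∃ a ∈ F ∪ B, a + d ∈ F ∪ B)) with hgood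
  set S1 := (Finset.range N).biUnion (fun i => bad (fun a => (2 * m - 1 + i) - a) (M1 i)) with hS1
  set S2 := (Finset.range N).biUnion
    (fun i => bad (fun a => (2 * n - (2 * m - 1 + i)) - a) (M2 i)) with hS2
  set S3 := (Finset.range (N - 1)).biUnion
    (fun i => bad (fun a => a + (n - (2 * m - 1 + i))) (M3 i)) with hS3
  have hcover : U.powerset ⊆ good ∪ (S1 ∪ (S2 ∪ S3)) := by
    intro B hB
    by_contra hcon
    simp only [Finset.mem_union, not_or] at hcon
    obtain ⟨hg, h1, h2, h3⟩ := hcon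
    apply hg
    rw [hgood, Finset.mem_filter]
    refine ⟨hB, ?_, ?_⟩
    · intro s hs1 hs2
      rcases le_or_gt s n with hsn | hsn
      · by_contra hno
        push Not at hno
        apply h1
        rw [hS1, Finset.mem_biUnion]
        refine ⟨(s - (2 * m - 1)).toNat, by rw [Finset.mem_range]; omega, ?_⟩
        rw [hbad, Finset.mem_filter]
        refine ⟨hB, fun a _ hab => hno a hab.1 ?_⟩
        convert hab.2 using 1
        dsimp only
        omega
      · by_contra hno
        push Not at hno
        apply h2
        rw [hS2, Finset.mem_biUnion]
        refine ⟨(2 * n - s - (2 * m - 1)).toNat, by rw [Finset.mem_range]; omega, ?_⟩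
        rw [hbad, Finset.mem_filter]
        refine ⟨hB, fun a _ hab => hno a hab.1 ?_⟩
        convert hab.2 using 1
        dsimp only
        omega
    · intro d hd1 hd2
      by_contra hno
      push Not at hno
      apply h3
      rw [hS3, Finset.mem_biUnion]
      refine ⟨(n - d - (2 * m - 1)).toNat, by rw [Finset.mem_range]; omega, ?_⟩
      rw [hbad, Finset.mem_filter]
      refine ⟨hB, fun a _ hab => hno a hab.1 ?_⟩
      convert hab.2 using 1
      dsimp only
      omega
  have union_bound : ∀ (K : ℕ) (f : ℕ → Finset (Finset ℤ)),
      (∀ i ∈ Finset.range K, ((f i).card : ℝ) ≤ (3 / 4 : ℝ) ^ (12 + i / 2) * 2 ^ U.card) →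
      ((((Finset.range K).biUnion f).card : ℕ) : ℝ) ≤ 8 * (3 / 4 : ℝ) ^ 12 * 2 ^ U.card := by
    intro K f hf
    calc ((((Finset.range K).biUnion f).card : ℕ) : ℝ) ≤ ∑ i ∈ Finset.range K, ((f i).card : ℝ) := by
          exact_mod_cast Finset.card_biUnion_le
      _ ≤ ∑ i ∈ Finset.range K, (3 / 4 : ℝ) ^ (12 + i / 2) * 2 ^ U.card := Finset.sum_le_sum hf
      _ = (∑ i ∈ Finset.range K, (3 / 4 : ℝ) ^ (12 + i / 2)) * 2 ^ U.card := by
          rw [Finset.sum_mul]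
      _ ≤ _ := by
          gcongr
          exact sum_range_three_quarters_pow_half_le K
  have c1 := union_bound N _ b1
  have c2 := union_bound N _ b2
  have c3 := union_bound (N - 1) _ b3
  have htot : (2 : ℝ) ^ U.card ≤ good.card + (S1.card + (S2.card + S3.card)) := by
    have h1 := Finset.card_le_card hcover
    rw [Finset.card_powerset] at h1
    have h2 := Finset.card_union_le good (S1 ∪ (S2 ∪ S3))
    have h3 := Finset.card_union_le S1 (S2 ∪ S3)
    have h4 := Finset.card_union_le S2 S3
    have h5 : 2 ^ U.card ≤ good.card + (S1.card + (S2.card + S3.card)) := by omega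
    exact_mod_cast h5
  have hpos : (0 : ℝ) < 2 ^ U.card := by positivity
  rw [← hS1] at c1
  rw [← hS2] at c2
  rw [← hS3] at c3
  -- The three bad families together have proportion at most `24 * (3/4) ^ 12 < 7/8`, which is why
  -- 12 spare pairs suffice.
  norm_num at c1 c2 c3
  linarith

/-! ### The fringes and their sums -/

/-- The left fringe. -/
def LeftFringe (j k : ℕ) (x : ℤ) : Prop :=
  0 ≤ x ∧ ((x < 8 * k + 8 ∧ (x % 8 = 0 ∨ x % 8 = 1 ∨ x % 8 = 3 ∨ x % 8 = 4)) ∨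
    16 * (k : ℤ) + 9 + j ≤ x)

/-- The right fringe, reflected. -/
def RightFringe (k : ℕ) (x : ℤ) : Prop :=
  0 ≤ x ∧ ((x < 8 * k ∧ (x % 8 = 0 ∨ x % 8 = 1 ∨ x % 8 = 2 ∨ x % 8 = 5)) ∨ 8 * (k : ℤ) ≤ x)

/-- `{0,1,3,4} + {0,1,3,4} = {0,…,8}`, so the `k + 1` blocks produce everything up to twice their
maximum `8k + 4`; the next sum comes from `0` and the tail, `j` places later than it could. -/
theorem exists_leftFringe_add_leftFringe_iff (j k : ℕ) (s : ℤ) :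
    (∃ a, LeftFringe j k a ∧ LeftFringe j k (s - a)) ↔
      0 ≤ s ∧ (s < 16 * k + 9 ∨ 16 * (k : ℤ) + 9 + j ≤ s) := by
  unfold LeftFringe
  constructor
  · rintro ⟨a, h1, h2⟩
    omega
  · rintro ⟨h0, h | h⟩
    · obtain ⟨q, t, hs, ht0, ht8, hq⟩ : ∃ q t : ℤ, s = 8 * q + t ∧ 0 ≤ t ∧ t ≤ 8 ∧ 0 ≤ q ∧
          q ≤ 2 * k := by
        -- The top sum needs remainder 8, as its quotient `2k + 1` exceeds the sum of two block
        -- indices.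
        rcases eq_or_ne s (16 * k + 8) with h | h
        · exact ⟨2 * k, 8, by omega, by omega, by omega, by omega, by omega⟩
        · exact ⟨s / 8, s % 8, by omega, by omega, by omega, by omega, by omega⟩
      obtain ⟨u, v, huv, hu0, hu, hv0, hv⟩ : ∃ u v : ℤ, u + v = q ∧ 0 ≤ u ∧ u ≤ k ∧ 0 ≤ v ∧
          v ≤ k := ⟨min q k, q - min q k, by omega, by omega, by omega, by omega, by omega⟩
      obtain ⟨b, hb, hb'⟩ : ∃ b : ℤ, (b = 0 ∨ b = 1 ∨ b = 3 ∨ b = 4) ∧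
          (t - b = 0 ∨ t - b = 1 ∨ t - b = 3 ∨ t - b = 4) := by
        obtain h | h | h | h : t = 0 ∨ t = 1 ∨ t = 3 ∨ t = 4 ∨ t = 2 ∨ t = 5 ∨ t = 6 ∨ t = 7 ∨ t = 8
            := by omega
        · exact ⟨0, by omega, by omega⟩
        · exact ⟨0, by omega, by omega⟩
        · exact ⟨0, by omega, by omega⟩
        · by_cases h2 : t = 2
          · exact ⟨1, by omega, by omega⟩
          · by_cases h6 : t = 6
            · exact ⟨3, by omega, by omega⟩
            · exact ⟨4, by omega, by omega⟩
      exact ⟨8 * u + b, by omega, by omega⟩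
    · exact ⟨0, by omega, by omega⟩

theorem exists_rightFringe_add_rightFringe_iff (k : ℕ) (s : ℤ) :
    (∃ a, RightFringe k a ∧ RightFringe k (s - a)) ↔ 0 ≤ s := by
  unfold RightFringe
  constructor
  · rintro ⟨a, h1, h2⟩
    omega
  · intro h0
    rcases lt_or_ge s (8 * k) with h | h
    · obtain h1 | h1 | h1 | h1 : (s % 8 = 0 ∨ s % 8 = 1 ∨ s % 8 = 2 ∨ s % 8 = 5) ∨
          (s % 8 = 3 ∨ s % 8 = 6) ∨ s % 8 = 4 ∨ s % 8 = 7 := by omega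
      · exact ⟨0, by omega, by omega⟩
      · exact ⟨1, by omega, by omega⟩
      · exact ⟨2, by omega, by omega⟩
      · exact ⟨2, by omega, by omega⟩
    · exact ⟨0, by omega, by omega⟩

/-- `{0,1,3,4} + {0,1,2,5}` omits exactly the class 7 mod 8, giving one loss in each of the `k`
right blocks. -/
theorem exists_leftFringe_add_rightFringe_iff (j k : ℕ) (s : ℤ) :
    (∃ a, LeftFringe j k a ∧ RightFringe k (s - a)) ↔
      0 ≤ s ∧ (s < 8 * k → s % 8 ≠ 7) := by
  unfold LeftFringe RightFringe
  constructor
  · rintro ⟨a, h1, h2⟩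
    omega
  · rintro ⟨h0, h⟩
    rcases lt_or_ge s (8 * k) with h' | h'
    · have := h h'
      obtain h1 | h1 | h1 : (s % 8 = 0 ∨ s % 8 = 1 ∨ s % 8 = 2 ∨ s % 8 = 5) ∨
          (s % 8 = 3 ∨ s % 8 = 6) ∨ s % 8 = 4 := by omega
      · exact ⟨0, by omega, by omega⟩
      · obtain h2 | h2 := h1
        · exact ⟨3, by omega, by omega⟩
        · exact ⟨1, by omega, by omega⟩
      · exact ⟨4, by omega, by omega⟩
    · exact ⟨0, by omega, by omega⟩

/-! ### Exact cardinalities for a fringed set -/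

section FringedSet

variable {j k : ℕ} {n m : ℤ} {A : Finset ℤ}

theorem card_add_self_of_fringe (hm : 2 * (16 * (k : ℤ) + 9 + j) ≤ m) (hn : 4 * m ≤ n)
    (hA : A ⊆ Finset.Icc 0 n) (hl : ∀ x < m, x ∈ A ↔ LeftFringe j k x)
    (hr : ∀ x < m, n - x ∈ A ↔ RightFringe k x)
    (hmid : ∀ s, 2 * m - 1 ≤ s → s ≤ 2 * n - 2 * m + 1 → ∃ a ∈ A, s - a ∈ A) :
    ((A + A).card : ℤ) = 2 * n + 1 - j := by
  have h0n : ∀ a ∈ A, 0 ≤ a ∧ a ≤ n := fun a ha => Finset.mem_Icc.1 (hA ha)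
  have hmem : ∀ s, s ∈ A + A ↔ ∃ a ∈ A, s - a ∈ A := by
    intro s
    rw [Finset.mem_add]
    constructor
    · rintro ⟨a, ha, b, hb, rfl⟩
      exact ⟨a, ha, by simpa using hb⟩
    · rintro ⟨a, ha, hb⟩
      exact ⟨a, ha, s - a, hb, by ring⟩
  have heq : A + A = Finset.Icc 0 (2 * n) \
      Finset.Ico (16 * (k : ℤ) + 9) (16 * (k : ℤ) + 9 + j) := by
    ext s
    rw [hmem, Finset.mem_sdiff, Finset.mem_Icc, Finset.mem_Ico]
    constructor
    · rintro ⟨a, ha, hb⟩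
      have h1 := h0n _ ha
      have h2 := h0n _ hb
      refine ⟨by omega, fun hs => ?_⟩
      have := (exists_leftFringe_add_leftFringe_iff j k s).1
        ⟨a, (hl _ (by omega)).1 ha, (hl _ (by omega)).1 hb⟩
      omega
    · rintro ⟨hs, hs'⟩
      rcases lt_or_ge s m with h | h
      · obtain ⟨a, ha, hb⟩ := (exists_leftFringe_add_leftFringe_iff j k s).2 (by omega)
        exact ⟨a, (hl _ (by have := hb.1; omega)).2 ha, (hl _ (by have := ha.1; omega)).2 hb⟩
      rcases lt_or_ge s (2 * m - 1) with h' | h'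
      -- Both halves of a sum in `[m, 2m - 2]` lie in the full part of the fringe, because `m` is at
      -- least twice its start.
      · have hh : ∀ a, 16 * (k : ℤ) + 9 + j ≤ a → a < m → a ∈ A :=
          fun a h1 h2 => (hl a h2).2 ⟨by omega, by omega⟩
        exact ⟨s / 2, hh _ (by omega) (by omega), hh _ (by omega) (by omega)⟩
      rcases le_or_gt s (2 * n - 2 * m + 1) with h'' | h''
      · exact hmid s h' h''
      rcases lt_or_ge (2 * n - s) m with h3 | h3
      · obtain ⟨a, ha, hb⟩ := (exists_rightFringe_add_rightFringe_iff k (2 * n - s)).2 (by omega)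
        refine ⟨n - a, (hr _ (by have := hb.1; omega)).2 ha, ?_⟩
        have := (hr _ (by have := ha.1; omega)).2 hb
        convert this using 1
        ring
      · have hh : ∀ a, 16 * (k : ℤ) + 9 + j ≤ n - a → n - a < m → a ∈ A := by
          intro a h1 h2
          have := (hr (n - a) h2).2 ⟨by omega, by omega⟩
          simpa using this
        exact ⟨s / 2, hh _ (by omega) (by omega), hh _ (by omega) (by omega)⟩
  rw [heq, Finset.card_sdiff_of_subset, Int.card_Icc, Int.card_Ico]
  · omega
  · intro x hx
    rw [Finset.mem_Ico] at hx
    rw [Finset.mem_Icc]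
    omega

theorem card_sub_self_of_fringe (hm : 2 * (16 * (k : ℤ) + 9 + j) ≤ m) (hn : 4 * m ≤ n)
    (hA : A ⊆ Finset.Icc 0 n) (hl : ∀ x < m, x ∈ A ↔ LeftFringe j k x)
    (hr : ∀ x < m, n - x ∈ A ↔ RightFringe k x)
    (hmid : ∀ d, 1 ≤ d → d ≤ n - 2 * m + 1 → ∃ a ∈ A, a + d ∈ A) :
    ((A - A).card : ℤ) = 2 * n + 1 - 2 * k := by
  have h0n : ∀ a ∈ A, 0 ≤ a ∧ a ≤ n := fun a ha => Finset.mem_Icc.1 (hA ha)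
  have hmem : ∀ d, d ∈ A - A ↔ ∃ a ∈ A, a + d ∈ A := by
    intro d
    rw [Finset.mem_sub]
    constructor
    · rintro ⟨a, ha, b, hb, rfl⟩
      exact ⟨b, hb, by simpa using ha⟩
    · rintro ⟨a, ha, hb⟩
      exact ⟨a + d, hb, a, ha, by ring⟩
  have hneg : ∀ d, d ∈ A - A ↔ -d ∈ A - A := by
    have : ∀ d, d ∈ A - A → -d ∈ A - A := by
      intro d
      rw [hmem, hmem]
      rintro ⟨a, ha, hb⟩
      exact ⟨a + d, hb, by simpa using ha⟩
    exact fun d => ⟨this d, fun h => by simpa using this _ h⟩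
  have hnonneg : ∀ d, 0 ≤ d → (d ∈ A - A ↔ d ≤ n ∧ (n - d < 8 * k → (n - d) % 8 ≠ 7)) := by
    intro d hd
    rw [hmem]
    constructor
    · rintro ⟨a, ha, hb⟩
      have h1 := h0n _ ha
      have h2 := h0n _ hb
      refine ⟨by omega, fun hs => ?_⟩
      have h3 : RightFringe k (n - d - a) := by
        refine (hr _ (by omega)).1 ?_
        convert hb using 1
        ring
      exact ((exists_leftFringe_add_rightFringe_iff j k (n - d)).1
        ⟨a, (hl _ (by omega)).1 ha, h3⟩).2 hs
    · rintro ⟨hdn, hs⟩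
      have hleft : ∀ a, 16 * (k : ℤ) + 9 + j ≤ a → a < m → a ∈ A :=
        fun a h1 h2 => (hl a h2).2 ⟨by omega, by omega⟩
      rcases lt_or_ge (n - d) m with h | h
      · obtain ⟨a, ha, hb⟩ := (exists_leftFringe_add_rightFringe_iff j k (n - d)).2 ⟨by omega, hs⟩
        refine ⟨a, (hl _ (by have := hb.1; omega)).2 ha, ?_⟩
        have := (hr _ (by have := ha.1; omega)).2 hb
        convert this using 1
        ring
      rcases lt_or_ge (n - d) (2 * m - 1) with h' | h'
      · refine ⟨(n - d) / 2, hleft _ (by omega) (by omega), ?_⟩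
        have := (hr (n - d - (n - d) / 2) (by omega)).2 ⟨by omega, by omega⟩
        convert this using 1
        ring
      rcases eq_or_lt_of_le hd with h0 | h0
      · exact ⟨m - 1, hleft _ (by omega) (by omega), by
          rw [← h0, add_zero]; exact hleft _ (by omega) (by omega)⟩
      · exact hmid d (by omega) (by omega)
  set X := (Finset.range k).image (fun i : ℕ => n - (8 * (i : ℤ) + 7)) with hX
  set Y := (Finset.range k).image (fun i : ℕ => (8 * (i : ℤ) + 7) - n) with hY
  have hXm : ∀ d, d ∈ X ↔ d ≤ n ∧ n - d < 8 * k ∧ (n - d) % 8 = 7 := by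
    intro d
    simp only [hX, Finset.mem_image, Finset.mem_range]
    constructor
    · rintro ⟨i, hi, rfl⟩
      omega
    · intro h
      exact ⟨((n - d) / 8).toNat, by omega, by omega⟩
  have hYm : ∀ d, d ∈ Y ↔ -d ≤ n ∧ n + d < 8 * k ∧ (n + d) % 8 = 7 := by
    intro d
    simp only [hY, Finset.mem_image, Finset.mem_range]
    constructor
    · rintro ⟨i, hi, rfl⟩
      omega
    · intro h
      exact ⟨((n + d) / 8).toNat, by omega, by omega⟩
  have hXc : X.card = k := by
    rw [hX, Finset.card_image_of_injective _ (fun a b h => by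
        have h : n - (8 * (a : ℤ) + 7) = n - (8 * (b : ℤ) + 7) := h
        omega),
      Finset.card_range]
  have hYc : Y.card = k := by
    rw [hY, Finset.card_image_of_injective _ (fun a b h => by
        have h : 8 * (a : ℤ) + 7 - n = 8 * (b : ℤ) + 7 - n := h
        omega),
      Finset.card_range]
  have hXY : Disjoint X Y := by
    rw [Finset.disjoint_left]
    intro d h1 h2
    rw [hXm] at h1
    rw [hYm] at h2
    omega
  have heq : A - A = Finset.Icc (-n) n \ (X ∪ Y) := by
    ext d
    rw [Finset.mem_sdiff, Finset.mem_Icc, Finset.mem_union, hXm, hYm]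
    rcases le_total 0 d with h | h
    · rw [hnonneg d h]
      omega
    · rw [hneg, hnonneg (-d) (by omega)]
      omega
  rw [heq, Finset.card_sdiff_of_subset, Int.card_Icc, Finset.card_union_of_disjoint hXY, hXc, hYc]
  · omega
  · intro d hd
    rw [Finset.mem_union, hXm, hYm] at hd
    rw [Finset.mem_Icc]
    omega

end FringedSet

/-! ### Assembling the family -/

theorem theorem8 (j k : ℕ) :
    ∃ c : ℝ, 0 < c ∧ c < 1 ∧ ∃ N : ℕ, ∀ n : ℕ, N ≤ n →
      c * (2 : ℝ) ^ (n + 1) ≤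
        (((Finset.Icc (0 : ℤ) (n : ℤ)).powerset.filter (fun A : Finset ℤ =>
          ((A + A).card : ℤ) = (2 * (n : ℤ) + 1) - (j : ℤ) ∧
          ((A - A).card : ℤ) = (2 * (n : ℤ) + 1) - 2 * (k : ℤ))).card : ℝ) := by
  classical
  set W : ℕ := 16 * k + 9 + j with hW
  set m : ℕ := 2 * W + 12 with hm
  -- `2m` of the `n + 1` membership choices are frozen, and an eighth of the rest succeed.
  refine ⟨1 / (2 ^ (2 * m) * 8), by positivity, ?_, 4 * m, fun n hn => ?_⟩
  · rw [div_lt_one (by positivity)]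
    have : (1 : ℝ) ≤ 2 ^ (2 * m) := one_le_pow₀ (by norm_num)
    linarith
  set F : Finset ℤ := (Finset.Icc (0 : ℤ) n).filter
    (fun x => (x < m ∧ LeftFringe j k x) ∨ (n - x < m ∧ RightFringe k (n - x))) with hF
  have hFm : ∀ x, x ∈ F ↔ (0 ≤ x ∧ x ≤ n) ∧
      ((x < m ∧ LeftFringe j k x) ∨ (n - x < m ∧ RightFringe k (n - x))) := by
    intro x
    rw [hF, Finset.mem_filter, Finset.mem_Icc]
  have hcount := eighth_le_card_full_middle n m W (by omega) (by omega) F (by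
    intro x hx
    rw [hFm]
    refine ⟨by omega, ?_⟩
    rcases hx with hx | hx
    · exact Or.inl ⟨by omega, by omega, Or.inr (by omega)⟩
    · exact Or.inr ⟨by omega, by omega, Or.inr (by omega)⟩)
  have hcard : (Finset.Icc (m : ℤ) (n - m)).card = n + 1 - 2 * m := by
    rw [Int.card_Icc]
    omega
  rw [hcard] at hcount
  have hpow : 1 / (2 ^ (2 * m) * 8) * (2 : ℝ) ^ (n + 1) = 2 ^ (n + 1 - 2 * m) / 8 := by
    have : (2 : ℝ) ^ (n + 1) = 2 ^ (n + 1 - 2 * m) * 2 ^ (2 * m) := by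
      rw [← pow_add]
      congr 1
      omega
    rw [this]
    field_simp
  rw [hpow]
  refine hcount.trans (Nat.cast_le.2 ?_)
  refine Finset.card_le_card_of_injOn (fun B => F ∪ B) ?_ ?_
  · intro B hB
    simp only [Finset.mem_coe, Finset.mem_filter, Finset.mem_powerset] at hB
    obtain ⟨hBU, hs, hd⟩ := hB
    have hBm : ∀ x ∈ B, (m : ℤ) ≤ x ∧ x ≤ n - m := fun x hx => Finset.mem_Icc.1 (hBU hx)
    have hsub : F ∪ B ⊆ Finset.Icc (0 : ℤ) n := by
      intro x hx
      rw [Finset.mem_Icc]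
      rcases Finset.mem_union.1 hx with h | h
      · exact ((hFm x).1 h).1
      · have := hBm x h
        omega
    have hl : ∀ x < (m : ℤ), x ∈ F ∪ B ↔ LeftFringe j k x := by
      intro x hx
      rw [Finset.mem_union, hFm]
      constructor
      · rintro (⟨_, h | h⟩ | h)
        · exact h.2
        · omega
        · have := hBm x h
          omega
      · intro h
        exact Or.inl ⟨⟨h.1, by omega⟩, Or.inl ⟨hx, h⟩⟩
    have hr : ∀ x < (m : ℤ), n - x ∈ F ∪ B ↔ RightFringe k x := by
      intro x hx
      rw [Finset.mem_union, hFm, sub_sub_cancel]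
      constructor
      · rintro (⟨_, h | h⟩ | h)
        · omega
        · exact h.2
        · have := hBm _ h
          omega
      · intro h
        exact Or.inl ⟨⟨by omega, by have := h.1; omega⟩, Or.inr ⟨hx, h⟩⟩
    simp only [Finset.mem_coe, Finset.mem_filter, Finset.mem_powerset]
    exact ⟨hsub,
      card_add_self_of_fringe (m := m) (by omega) (by omega) hsub hl hr hs,
      card_sub_self_of_fringe (m := m) (by omega) (by omega) hsub hl hr hd⟩
  · intro B hB C hC h
    simp only [Finset.mem_coe, Finset.mem_filter, Finset.mem_powerset] at hB hC
    have hdisj : ∀ D : Finset ℤ, D ⊆ Finset.Icc (m : ℤ) (n - m) → (F ∪ D) \ F = D := by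
      intro D hD
      rw [Finset.union_sdiff_left, Finset.sdiff_eq_self_iff_disjoint, Finset.disjoint_left]
      intro x hx hxF
      have h1 := Finset.mem_Icc.1 (hD hx)
      have h2 := ((hFm x).1 hxF).2
      omega
    simp only at h
    rw [← hdisj B hB.1, ← hdisj C hC.1, h]
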